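/- Let $\mathcal{L}=\{l_1,\dots,l_s\}$ be a set of $s\ge 1$ nonnegative integers with $0\le l_1<l_2<\cdots<l_s$, let $\mathbb{F}_q$ be a finite field of order $q$, and let $\mathcal{V}$ be a family of (pairwise distinct) subspaces of an $n$-dimensional vector space over $\mathbb{F}_q$ such that (i) $\dim(V_i\cap V_j)\in\mathcal{L}$ for any distinct $V_i,V_j\in\mathcal{V}$ and (ii) $\dim(V_i)\notin\mathcal{L}$ for each $V_i\in\mathcal{V}$. For integers $m,r\ge 0$ write $$\genfrac{[}{]}{0pt}{}{m}{r}=\prod_{0\le i\le r-1}\frac{q^{m-i}-1}{q^{r-i}-1}.$$ Then $\mathcal{V}$ is Sperner, i.e. no member of $\mathcal{V}$ is contained in another member. Moreover, if $$n\ \ge\ \max\left\{\log_q\left((q^s-1)\genfrac{[}{]}{0pt}{}{k^2}{l_1+1}+1\right)+l_1,\ 2s+1\right\},\qquad k=\max_{V\in\mathcal{V}}\dim(V)$$ (with $k=0$ if $\mathcal{V}$ is empty), then $$|\mathcal{V}|\le\genfrac{[}{]}{0pt}{}{n}{s},$$ and if $|\mathcal{V}|=\genfrac{[}{]}{0pt}{}{n}{s}$,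 then $\mathcal{L}=\{0,1,\dots,s-1\}$. -/

import Mathlib

/-- The Gaussian binomial coefficient `∏_{0 ≤ i ≤ k-1} (q^(n-i) - 1) / (q^(k-i) - 1)`, as a real
number. The exponents `k - i` never truncate since `i < k`; the exponent `n - i` truncates only
when `n < i < k`, and then the factor with `i = n` makes the whole product zero, exactly as it does
with integer exponents. -/
noncomputable def gaussBinom (q : ℝ) (n k : ℕ) : ℝ :=
  ∏ i ∈ Finset.range k, (q ^ (n - i) - 1) / (q ^ (k - i) - 1)

/-- The maximum dimension of a member of a finite family of subspaces (`0` for the empty family). -/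
noncomputable def maxDim {F W : Type*} [Field F] [AddCommGroup W] [Module F W]
    (𝒱 : Finset (Submodule F W)) : ℕ :=
  𝒱.sup fun V => Module.finrank F V

/-! If `U ≤ V` were distinct members, `U ⊓ V = U` would have its dimension both in `L` and not in
`L`; so the family is Sperner.

For the bound, if `L = {0, …, s-1}`, every member has dimension at least `s` and no two share an
`s`-subspace, so choosing one `s`-subspace in each is injective. For every other `L` the inequality
is strict. The main tool is the Frankl–Wilson type bound `card_le_gaussBinomSum`, at most `∑_{j ≤ s}
[n, j]` members. This slightly exceeds `[n, s]`, and the excess is removed by passing to quotients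
(`card_le_gaussBinomSum_of_forall_le`).

If `0 ∈ L`, members of dimension at most `s` only meet in dimensions from `L ∩ [0, s)`, which has
fewer than `s` elements; larger members are counted through nonzero vectors `v`, where dividing by
`v` removes `0` from `L`. If `l₁ > 0`, a sunflower argument (`exists_small_or_common`) gives either
a common `l₁`-subspace to divide by, or a subspace of dimension at most `k ^ 2` meeting every member
in dimension above `l₁`; in the latter case the logarithmic condition on `n` pays for the choice of
an `(l₁ + 1)`-subspace in it. -/

section SubspaceFamilies

open Module

/-! ### Gaussian binomial coefficients: identities and estimates. -/

theorem gaussBinom_zero_right (q : ℝ) (m : ℕ) : gaussBinom q m 0 = 1 := by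
  simp [gaussBinom]

theorem gaussBinom_nonneg {q : ℝ} (hq : 1 ≤ q) (m j : ℕ) : 0 ≤ gaussBinom q m j :=
  Finset.prod_nonneg fun _ _ =>
    div_nonneg (sub_nonneg.2 (one_le_pow₀ hq)) (sub_nonneg.2 (one_le_pow₀ hq))

theorem gaussBinom_mono_left {q : ℝ} (hq : 1 ≤ q) {m m' : ℕ} (h : m ≤ m') (j : ℕ) :
    gaussBinom q m j ≤ gaussBinom q m' j := by
  refine Finset.prod_le_prod (fun _ _ => div_nonneg (sub_nonneg.2 (one_le_pow₀ hq))
    (sub_nonneg.2 (one_le_pow₀ hq))) fun i _ => ?_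
  refine div_le_div_of_nonneg_right ?_ (sub_nonneg.2 (one_le_pow₀ hq))
  have := pow_le_pow_right₀ hq (show m - i ≤ m' - i by omega)
  linarith

theorem gaussBinom_pos {q : ℝ} (hq : 1 < q) {m j : ℕ} (h : j ≤ m) : 0 < gaussBinom q m j := by
  refine Finset.prod_pos fun i hi => ?_
  have hi := Finset.mem_range.1 hi
  exact div_pos (sub_pos.2 (one_lt_pow₀ hq (by omega))) (sub_pos.2 (one_lt_pow₀ hq (by omega)))

theorem gaussBinom_eq_zero {q : ℝ} {m j : ℕ} (h : m < j) : gaussBinom q m j = 0 :=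
  Finset.prod_eq_zero (Finset.mem_range.2 h) (by simp)

theorem gaussBinom_succ_succ {q : ℝ} (hq : 1 < q) (m j : ℕ) :
    gaussBinom q (m + 1) (j + 1) * (q ^ (j + 1) - 1) = gaussBinom q m j * (q ^ (m + 1) - 1) := by
  have : q ^ (j + 1) - 1 ≠ 0 := (sub_pos.2 (one_lt_pow₀ hq (by omega))).ne'
  simp only [gaussBinom, Finset.prod_range_succ', Nat.add_sub_add_right, Nat.sub_zero]
  field_simp

theorem gaussBinom_mul_prod {q : ℝ} (hq : 1 < q) (m j : ℕ) :
    gaussBinom q m j * ∏ i ∈ Finset.range j, (q ^ (i + 1) - 1)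
      = ∏ i ∈ Finset.range j, (q ^ (m - i) - 1) := by
  have h : ∏ i ∈ Finset.range j, (q ^ (i + 1) - 1) = ∏ i ∈ Finset.range j, (q ^ (j - i) - 1) := by
    rw [← Finset.prod_range_reflect]
    refine Finset.prod_congr rfl fun i hi => ?_
    have hi := Finset.mem_range.1 hi
    rw [show j - 1 - i + 1 = j - i by omega]
  rw [h, gaussBinom, ← Finset.prod_mul_distrib]
  refine Finset.prod_congr rfl fun i hi => ?_
  have hi := Finset.mem_range.1 hi
  exact div_mul_cancel₀ _ (sub_pos.2 (one_lt_pow₀ hq (by omega))).ne'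

theorem gaussBinom_succ_right {q : ℝ} (hq : 1 < q) (m j : ℕ) :
    gaussBinom q m (j + 1) * (q ^ (j + 1) - 1) = gaussBinom q m j * (q ^ (m - j) - 1) := by
  have hpos : 0 < ∏ i ∈ Finset.range j, (q ^ (i + 1) - 1) :=
    Finset.prod_pos fun i _ => sub_pos.2 (one_lt_pow₀ hq (by omega))
  have h1 := gaussBinom_mul_prod hq m (j + 1)
  have h2 := gaussBinom_mul_prod hq m j
  rw [Finset.prod_range_succ, Finset.prod_range_succ, ← h2] at h1
  refine mul_right_cancel₀ hpos.ne' ?_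
  linear_combination h1

/-- The partial sums of a row of Gaussian binomial coefficients. -/
noncomputable def gaussBinomSum (q : ℝ) (m r : ℕ) : ℝ :=
  ∑ j ∈ Finset.range (r + 1), gaussBinom q m j

theorem gaussBinomSum_mono {q : ℝ} (hq : 1 ≤ q) {m m' r r' : ℕ} (hm : m ≤ m') (hr : r ≤ r') :
    gaussBinomSum q m r ≤ gaussBinomSum q m' r' :=
  (Finset.sum_le_sum fun j _ => gaussBinom_mono_left hq hm j).trans
    (Finset.sum_le_sum_of_subset_of_nonneg (Finset.range_subset_range.2 (by omega))
      fun _ _ _ => gaussBinom_nonneg hq _ _)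

theorem one_le_gaussBinomSum {q : ℝ} (hq : 1 ≤ q) (m r : ℕ) : 1 ≤ gaussBinomSum q m r := by
  refine le_trans ?_ (gaussBinomSum_mono hq le_rfl (Nat.zero_le r))
  simp [gaussBinomSum, gaussBinom_zero_right]

/-- The ratio of consecutive coefficients is `(q^(m-j) - 1) / (q^(j+1) - 1)`, and `m - j ≥ d + (j +
1)`. -/
theorem pow_mul_gaussBinom_le {q : ℝ} (hq : 1 < q) {m j d : ℕ} (h : 2 * j + 1 + d ≤ m) :
    q ^ d * gaussBinom q m j ≤ gaussBinom q m (j + 1) := by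
  have hpos : 0 < q ^ (j + 1) - 1 := sub_pos.2 (one_lt_pow₀ hq (by omega))
  refine le_of_mul_le_mul_right ?_ hpos
  rw [gaussBinom_succ_right hq]
  have h1 : q ^ d * (q ^ (j + 1) - 1) ≤ q ^ (m - j) - 1 := by
    have h2 : q ^ (d + (j + 1)) ≤ q ^ (m - j) := pow_le_pow_right₀ hq.le (by omega)
    have h3 : 1 ≤ q ^ d := one_le_pow₀ hq.le
    rw [pow_add] at h2
    linarith
  have := mul_le_mul_of_nonneg_left h1 (gaussBinom_nonneg hq.le m j)
  linarith

/-- In this range the coefficients grow by a factor of at least `q^2 ≥ 4`, so a geometric series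
gives `1 / (1 - 1/4) = 4/3`. -/
theorem gaussBinomSum_le {q : ℝ} (hq : 2 ≤ q) {m r : ℕ} (h : 2 * r + 1 ≤ m) :
    3 * gaussBinomSum q m r ≤ 4 * gaussBinom q m r := by
  induction r with
  | zero => norm_num [gaussBinomSum, gaussBinom_zero_right]
  | succ r ih =>
    have h1 := ih (by omega)
    have h2 := pow_mul_gaussBinom_le (q := q) (by linarith) (m := m) (j := r) (d := 2) (by omega)
    have h3 := gaussBinom_nonneg (by linarith : 1 ≤ q) m r
    rw [gaussBinomSum, Finset.sum_range_succ, ← gaussBinomSum]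
    nlinarith [mul_le_mul_of_nonneg_right (show (4 : ℝ) ≤ q ^ 2 by nlinarith) h3]

theorem three_mul_gaussBinomSum_le {q : ℝ} (hq : 2 ≤ q) {m r : ℕ} (h : 2 * r + 3 ≤ m) :
    3 * gaussBinomSum q m r ≤ gaussBinom q m (r + 1) := by
  have h1 := gaussBinomSum_le hq (show 2 * r + 1 ≤ m by omega)
  have h2 := pow_mul_gaussBinom_le (q := q) (by linarith) (m := m) (j := r) (d := 2) (by omega)
  have h3 := gaussBinom_nonneg (by linarith : 1 ≤ q) m r
  nlinarith [mul_le_mul_of_nonneg_right (show (4 : ℝ) ≤ q ^ 2 by nlinarith) h3]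

/-- Losing one dimension gains a factor of at least 2, while the sum is at most `1 + (4/3) / 2 =
5/3` times its last term. -/
theorem gaussBinomSum_lt {q : ℝ} (hq : 2 ≤ q) {m r : ℕ} (h : 2 * r + 2 ≤ m) :
    gaussBinomSum q m (r + 1) < gaussBinom q (m + 1) (r + 1) := by
  have hq1 : 1 < q := by linarith
  have h1 := gaussBinomSum_le hq (show 2 * r + 1 ≤ m by omega)
  have h2 := pow_mul_gaussBinom_le hq1 (m := m) (j := r) (d := 1) (by omega)
  have h3 := gaussBinom_nonneg hq1.le m r
  have h4 := gaussBinom_succ_succ hq1 m r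
  have h5 := gaussBinom_succ_right hq1 m r
  have hb : 0 < gaussBinom q m (r + 1) := gaussBinom_pos hq1 (by omega)
  have h6 : 2 * gaussBinom q m (r + 1) ≤ gaussBinom q (m + 1) (r + 1) := by
    refine le_of_mul_le_mul_right ?_ (sub_pos.2 (one_lt_pow₀ hq1 (Nat.succ_ne_zero r)))
    rw [h4, mul_assoc, h5]
    have h7 : q * q ^ (m - r) ≤ q ^ (m + 1) := by
      rw [← pow_succ']; exact pow_le_pow_right₀ hq1.le (by omega)
    have h8 : 2 * q ^ (m - r) ≤ q * q ^ (m - r) := by gcongr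
    nlinarith
  rw [gaussBinomSum, Finset.sum_range_succ, ← gaussBinomSum]
  nlinarith [mul_le_mul_of_nonneg_right hq h3]

/-! ### Counting subspaces of a given dimension. -/

section Count

variable {F W : Type*} [Field F] [Fintype F] [AddCommGroup W] [Module F W] [FiniteDimensional F W]

/-- Independent `j`-tuples are grouped by their span. -/
theorem card_linearIndependent_eq_mul (j : ℕ) :
    Nat.card {v : Fin j → W // LinearIndependent F v} =
      Nat.card {U : Submodule F W // finrank F U = j} * ∏ i : Fin j,
        (Fintype.card F ^ j - Fintype.card F ^ (i : ℕ)) := by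
  classical
  have : Finite W := Module.finite_of_finite F
  have : Fintype {U : Submodule F W // finrank F U = j} := Fintype.ofFinite _
  let f : (Σ U : {U : Submodule F W // finrank F U = j},
      {v : Fin j → U.1 // LinearIndependent F v}) → {v : Fin j → W // LinearIndependent F v} :=
    fun x => ⟨fun i => (x.2.1 i : W), x.2.2.map' x.1.1.subtype (Submodule.ker_subtype _)⟩
  have hspan : ∀ x, Submodule.span F (Set.range (f x).1) = x.1.1 := by
    intro x
    refine Submodule.eq_of_le_of_finrank_eq ?_ ?_
    · rw [Submodule.span_le]
      rintro _ ⟨i, rfl⟩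
      exact (x.2.1 i).2
    · rw [finrank_span_eq_card (f x).2, x.1.2, Fintype.card_fin]
  have hf : Function.Bijective f := by
    constructor
    · rintro ⟨⟨U, hU⟩, v, hv⟩ ⟨⟨U', hU'⟩, v', hv'⟩ h
      have h1 := hspan ⟨⟨U, hU⟩, v, hv⟩
      rw [h, hspan] at h1
      obtain rfl : U' = U := h1
      obtain rfl : v = v' := by
        funext i
        exact Subtype.ext (congrFun (congrArg Subtype.val h) i)
      rfl
    · rintro ⟨v, hv⟩
      refine ⟨⟨⟨Submodule.span F (Set.range v), by simpa using finrank_span_eq_card hv⟩,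
        fun i => ⟨v i, Submodule.subset_span ⟨i, rfl⟩⟩, linearIndependent_span hv⟩, rfl⟩
  rw [← Nat.card_congr (Equiv.ofBijective f hf), Nat.card_sigma]
  rw [Finset.sum_congr rfl fun U _ => (by
    rw [card_linearIndependent (K := F) (V := U.1) U.2.ge, U.2] :
    Nat.card {v : Fin j → U.1 // LinearIndependent F v} = ∏ i : Fin j,
        (Fintype.card F ^ j - Fintype.card F ^ (i : ℕ)))]
  simp [Nat.card_eq_fintype_card]

theorem cast_prod_pow_sub_pow {q m j : ℕ} (hq : 1 ≤ q) (h : j ≤ m) :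
    ((∏ i : Fin j, (q ^ m - q ^ (i : ℕ)) : ℕ) : ℝ) =
      (∏ i ∈ Finset.range j, (q : ℝ) ^ i) * ∏ i ∈ Finset.range j, ((q : ℝ) ^ (m - i) - 1) := by
  rw [Fin.prod_univ_eq_prod_range (fun i => q ^ m - q ^ i), ← Finset.prod_mul_distrib,
    Nat.cast_prod]
  refine Finset.prod_congr rfl fun i hi => ?_
  have hi := Finset.mem_range.1 hi
  rw [Nat.cast_sub (Nat.pow_le_pow_right hq (by omega)), mul_sub, ← pow_add,
    Nat.add_sub_cancel' (by omega)]
  simp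

theorem card_submodule_finrank_eq (j : ℕ) :
    (Nat.card {U : Submodule F W // finrank F U = j} : ℝ) =
      gaussBinom (Fintype.card F) (finrank F W) j := by
  have : Finite W := Module.finite_of_finite F
  have hq : 1 < Fintype.card F := Fintype.one_lt_card
  have hq' : (1 : ℝ) < Fintype.card F := by exact_mod_cast hq
  rcases le_or_gt j (finrank F W) with h | h
  · have h1 := congrArg (Nat.cast : ℕ → ℝ) (card_linearIndependent_eq_mul (F := F) (W := W) j)
    rw [card_linearIndependent h, Nat.cast_mul, cast_prod_pow_sub_pow hq.le h,
      cast_prod_pow_sub_pow hq.le le_rfl] at h1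
    have h2 : ∏ i ∈ Finset.range j, (Fintype.card F : ℝ) ^ i ≠ 0 :=
      (Finset.prod_pos fun i _ => by positivity).ne'
    have h3 : ∏ i ∈ Finset.range j, ((Fintype.card F : ℝ) ^ (j - i) - 1) ≠ 0 :=
      (Finset.prod_pos fun i hi => sub_pos.2 (one_lt_pow₀ hq' (by
        have := Finset.mem_range.1 hi; omega))).ne'
    rw [gaussBinom, Finset.prod_div_distrib, eq_div_iff h3]
    refine mul_left_cancel₀ h2 ?_
    linear_combination -h1
  · rw [gaussBinom_eq_zero h]
    have : IsEmpty {U : Submodule F W // finrank F U = j} :=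
      ⟨fun U => absurd (Submodule.finrank_le U.1) (by rw [U.2]; omega)⟩
    simp

end Count

/-! ### The Frankl–Wilson bound by linear independence of functions. -/

section Indicator

variable {F W : Type*} [Field F] [AddCommGroup W] [Module F W]

open Classical in
/-- The indicator function of the subspaces containing a given subspace `U`. -/
noncomputable def containmentIndicator (U X : Submodule F W) : ℝ := if U ≤ X then 1 else 0

/-- The span of the containment indicators of the subspaces of dimension at most `r`. -/
noncomputable def indicatorSpan (F W : Type*) [Field F] [AddCommGroup W] [Module F W] (r : ℕ) :
    Submodule ℝ (Submodule F W → ℝ) :=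
  Submodule.span ℝ (containmentIndicator '' {U | finrank F U ≤ r})

theorem indicatorSpan_mono {r r' : ℕ} (h : r ≤ r') : indicatorSpan F W r ≤ indicatorSpan F W r' :=
  Submodule.span_mono (Set.image_mono fun _ hU => le_trans hU h)

theorem containmentIndicator_mul_span_singleton (U X : Submodule F W) (v : W) :
    containmentIndicator U X * containmentIndicator (F ∙ v) X
      = containmentIndicator (U ⊔ F ∙ v) X := by
  by_cases h : U ≤ X <;> by_cases h' : v ∈ X <;>
    simp [containmentIndicator, h, h', Submodule.span_singleton_le_iff_mem]

/-- `indicatorSpan` plays the role of polynomials of degree at most `r`: adjoining one vector raises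
the degree by at most one. -/
theorem mul_indicator_span_singleton_mem [FiniteDimensional F W] {r : ℕ} {g : Submodule F W → ℝ}
    (hg : g ∈ indicatorSpan F W r) (v : W) :
    (fun X => g X * containmentIndicator (F ∙ v) X) ∈ indicatorSpan F W (r + 1) := by
  induction hg using Submodule.span_induction with
  | mem g hg =>
    obtain ⟨U, hU, rfl⟩ := hg
    simp only [containmentIndicator_mul_span_singleton]
    refine Submodule.subset_span ⟨U ⊔ F ∙ v, ?_, rfl⟩
    have h1 := Submodule.finrank_add_le_finrank_add_finrank U (F ∙ v)
    have h2 : finrank F (F ∙ v) ≤ 1 := by simpa using finrank_span_le_card (R := F) ({v} : Set W)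
    have hU : finrank F U ≤ r := hU
    show finrank F (U ⊔ F ∙ v : Submodule F W) ≤ r + 1
    omega
  | zero =>
    simp only [Pi.zero_apply, zero_mul]
    exact (indicatorSpan F W (r + 1)).zero_mem
  | add x y _ _ hx hy => simpa [add_mul, Pi.add_def] using add_mem hx hy
  | smul a x _ hx =>
    simpa [mul_assoc, Pi.smul_def] using Submodule.smul_mem _ a hx

open Classical in
-- Both sides count the vectors of `X ⊓ V`; thus the left side has degree at most one in `X`.
theorem pow_finrank_inf_eq_sum [Fintype F] [Fintype W] (V X : Submodule F W) :
    ((Fintype.card F : ℝ) ^ finrank F (X ⊓ V : Submodule F W)) =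
      ∑ v ∈ Finset.univ.filter (· ∈ V), containmentIndicator (F ∙ v) X := by
  have h := Module.card_eq_pow_finrank (K := F) (V := (X ⊓ V : Submodule F W))
  rw [← Nat.cast_pow, ← h]
  simp only [containmentIndicator, Submodule.span_singleton_le_iff_mem, Finset.sum_boole,
    Finset.filter_filter]
  rw [Fintype.card_subtype]
  simp [and_comm]

theorem prod_pow_finrank_inf_sub_mem [Fintype F] [FiniteDimensional F W] (V : Submodule F W) (L : Finset ℕ) :
    (fun X : Submodule F W => ∏ l ∈ L,
      ((Fintype.card F : ℝ) ^ finrank F (X ⊓ V : Submodule F W) - (Fintype.card F : ℝ) ^ l))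
      ∈ indicatorSpan F W L.card := by
  classical
  have : Finite W := Module.finite_of_finite F
  have : Fintype W := Fintype.ofFinite W
  induction L using Finset.induction_on with
  | empty =>
    refine Submodule.subset_span ⟨⊥, by simp, ?_⟩
    funext X
    simp [containmentIndicator]
  | insert l L hl ih =>
    rw [Finset.card_insert_of_notMem hl]
    simp only [Finset.prod_insert hl]
    set g := fun X : Submodule F W => ∏ l ∈ L,
      ((Fintype.card F : ℝ) ^ finrank F (X ⊓ V : Submodule F W) - (Fintype.card F : ℝ) ^ l)
    have h : (fun X : Submodule F W => ((Fintype.card F : ℝ) ^ finrank F (X ⊓ V : Submodule F W)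
        - (Fintype.card F : ℝ) ^ l) * g X) =
        (∑ v ∈ Finset.univ.filter (· ∈ V), fun X => g X * containmentIndicator (F ∙ v) X)
          - ((Fintype.card F : ℝ) ^ l) • g := by
      funext X
      rw [pow_finrank_inf_eq_sum]
      simp [Finset.sum_apply, sub_mul, Finset.sum_mul, mul_comm]
    exact h ▸ sub_mem (sum_mem fun v _ => mul_indicator_span_singleton_mem ih v)
      (Submodule.smul_mem _ _ (indicatorSpan_mono (Nat.le_succ _) ih))

theorem natCard_submodule_finrank_le [Fintype F] [FiniteDimensional F W] (r : ℕ) :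
    (Nat.card {U : Submodule F W // finrank F U ≤ r} : ℝ) =
      gaussBinomSum (Fintype.card F) (finrank F W) r := by
  classical
  have : Finite W := Module.finite_of_finite F
  have : Fintype (Submodule F W) := Fintype.ofFinite _
  simp only [gaussBinomSum, ← card_submodule_finrank_eq]
  rw [← Nat.cast_sum]
  congr 1
  simp only [Nat.card_eq_fintype_card, Fintype.card_subtype]
  rw [Finset.card_eq_sum_card_fiberwise (f := fun U : Submodule F W => finrank F U)
    (t := Finset.range (r + 1)) (by intro U hU; simpa [Nat.lt_succ_iff] using hU)]
  refine Finset.sum_congr rfl fun j hj => ?_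
  have hj := Finset.mem_range.1 hj
  congr 1
  ext U
  simp only [Finset.mem_filter, Finset.mem_univ, true_and]
  omega

/-- The nonuniform subspace analogue of the Frankl–Wilson bound. -/
theorem card_le_gaussBinomSum [Fintype F] [FiniteDimensional F W] {L : Finset ℕ} {𝒱 : Finset (Submodule F W)}
    (hinter : ∀ U ∈ 𝒱, ∀ V ∈ 𝒱, U ≠ V → finrank F (U ⊓ V : Submodule F W) ∈ L)
    (hdim : ∀ V ∈ 𝒱, finrank F V ∉ L) {r : ℕ} (hr : L.card ≤ r) :
    (𝒱.card : ℝ) ≤ gaussBinomSum (Fintype.card F) (finrank F W) r := by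
  classical
  have : Finite W := Module.finite_of_finite F
  have : Fintype (Submodule F W) := Fintype.ofFinite _
  have hq : (1 : ℝ) < Fintype.card F := by exact_mod_cast Fintype.one_lt_card
  let f : 𝒱 → Submodule F W → ℝ := fun V X => ∏ l ∈ L,
      ((Fintype.card F : ℝ) ^ finrank F (X ⊓ V.1 : Submodule F W) - (Fintype.card F : ℝ) ^ l)
  -- The matrix of values `f V U` is diagonal: it vanishes for `U ≠ V` by `hinter` and is nonzero
  -- for `U = V` by `hdim`.
  have hf : LinearIndependent ℝ f := by
    rw [Fintype.linearIndependent_iff]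
    intro c hc V
    have h1 := congrFun hc V.1
    rw [Finset.sum_apply, Finset.sum_eq_single V] at h1
    · refine (mul_eq_zero.1 h1).resolve_right (Finset.prod_ne_zero_iff.2 fun l hl h => ?_)
      rw [inf_idem, sub_eq_zero] at h
      exact hdim V.1 V.2 (pow_right_injective₀ (by linarith) hq.ne' h ▸ hl)
    · intro U _ hU
      refine mul_eq_zero_of_right _ (Finset.prod_eq_zero
        (hinter V.1 V.2 U.1 U.2 fun h => hU (Subtype.ext h.symm)) (sub_self _))
    · simp
  have h1 : Set.range f ≤ Submodule.span ℝ
      (Set.range fun U : {U : Submodule F W // finrank F U ≤ r} => containmentIndicator U.1) := by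
    rintro _ ⟨V, rfl⟩
    have h := indicatorSpan_mono hr (prod_pow_finrank_inf_sub_mem V.1 L)
    rwa [indicatorSpan, Set.image_eq_range] at h
  have h2 := linearIndependent_le_span' f hf _ h1
  rw [Cardinal.mk_fintype, Fintype.card_coe] at h2
  rw [← natCard_submodule_finrank_le, Nat.cast_le, Nat.card_eq_fintype_card]
  exact (Nat.cast_le.1 h2).trans (Fintype.card_range_le _)

end Indicator

/-! ### Passing to the quotient by a common subspace. -/

section Quotient

variable {F W : Type*} [Field F] [AddCommGroup W] [Module F W]

theorem finrank_map_mkQ_add [FiniteDimensional F W] {Z V : Submodule F W} (h : Z ≤ V) :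
    finrank F (V.map Z.mkQ) + finrank F Z = finrank F V := by
  have h1 := (Z.mkQ.domRestrict V).finrank_range_add_finrank_ker
  rw [LinearMap.range_domRestrict, LinearMap.ker_domRestrict, Submodule.ker_mkQ,
    ← Submodule.submoduleOf, (Submodule.submoduleOfEquivOfLe h).finrank_eq] at h1
  exact h1

theorem map_mkQ_inf {Z U V : Submodule F W} (hU : Z ≤ U) (hV : Z ≤ V) :
    (U ⊓ V).map Z.mkQ = U.map Z.mkQ ⊓ V.map Z.mkQ := by
  refine Submodule.comap_injective_of_surjective Z.mkQ_surjective ?_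
  rw [Submodule.comap_inf]
  simp [Submodule.comap_map_mkQ, hU, hV]

theorem map_mkQ_injOn (Z : Submodule F W) :
    Set.InjOn (fun V : Submodule F W => V.map Z.mkQ) {V | Z ≤ V} := by
  intro U hU V hV h
  have h1 := congrArg (Submodule.comap Z.mkQ) h
  simpa [Submodule.comap_map_mkQ, sup_eq_right.2 hU.out, sup_eq_right.2 hV.out] using h1

theorem card_le_gaussBinomSum_of_forall_le [Fintype F] [FiniteDimensional F W]
    {L : Finset ℕ} {𝒱 : Finset (Submodule F W)}
    {Z : Submodule F W} (hZ : ∀ V ∈ 𝒱, Z ≤ V) (hL : ∀ l ∈ L, finrank F Z ≤ l)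
    (hinter : ∀ U ∈ 𝒱, ∀ V ∈ 𝒱, U ≠ V → finrank F (U ⊓ V : Submodule F W) ∈ L)
    (hdim : ∀ V ∈ 𝒱, finrank F V ∉ L) {r : ℕ} (hr : L.card ≤ r) :
    (𝒱.card : ℝ) ≤ gaussBinomSum (Fintype.card F) (finrank F W - finrank F Z) r := by
  classical
  have hinj : Set.InjOn (fun V : Submodule F W => V.map Z.mkQ) 𝒱 := (map_mkQ_injOn Z).mono hZ
  rw [← Finset.card_image_of_injOn hinj, ← Submodule.finrank_quotient]
  -- All dimensions drop by `finrank F Z`; by `hL` the subtraction on `L` never truncates.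
  refine card_le_gaussBinomSum (L := L.image (· - finrank F Z)) ?_ ?_
    (Finset.card_image_le.trans hr)
  · simp only [Finset.forall_mem_image]
    intro U hU V hV h
    rw [← map_mkQ_inf (hZ U hU) (hZ V hV)]
    have h1 := finrank_map_mkQ_add (le_inf (hZ U hU) (hZ V hV))
    exact Finset.mem_image.2 ⟨_, hinter U hU V hV (ne_of_apply_ne _ h), by omega⟩
  · simp only [Finset.forall_mem_image]
    intro V hV h
    obtain ⟨l, hl, h⟩ := Finset.mem_image.1 h
    have h1 := finrank_map_mkQ_add (hZ V hV)
    have h2 := hL l hl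
    exact hdim V hV (by rwa [show finrank F V = l by omega])

end Quotient

/-! ### Families whose members share no `s`-subspace. -/

section Subspaces

variable {F W : Type*} [Field F] [AddCommGroup W] [Module F W] [FiniteDimensional F W]

theorem exists_le_finrank_eq (V : Submodule F W) {j : ℕ} (h : j ≤ finrank F V) :
    ∃ U ≤ V, finrank F U = j := by
  let b := finBasis F V
  have hb : LinearIndependent F fun i : Fin j => (b (Fin.castLE h i) : W) :=
    (b.linearIndependent.comp _ (Fin.castLE_injective h)).map' V.subtype (Submodule.ker_subtype _)
  refine ⟨Submodule.span F (Set.range fun i : Fin j => (b (Fin.castLE h i) : W)), ?_, ?_⟩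
  · rw [Submodule.span_le]
    rintro _ ⟨i, rfl⟩
    exact (b _).2
  · simpa using finrank_span_eq_card hb

/-- A family of subspaces of dimension at least `s`, no two of which share an `s`-dimensional
subspace, has at most as many members as there are `s`-dimensional subspaces. -/
theorem card_le_gaussBinom_of_finrank_inf_lt [Fintype F] {s : ℕ} {𝒱 : Finset (Submodule F W)}
    (hinter : ∀ U ∈ 𝒱, ∀ V ∈ 𝒱, U ≠ V → finrank F (U ⊓ V : Submodule F W) < s)
    (hdim : ∀ V ∈ 𝒱, s ≤ finrank F V) :
    (𝒱.card : ℝ) ≤ gaussBinom (Fintype.card F) (finrank F W) s := by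
  classical
  have : Finite W := Module.finite_of_finite F
  choose f hf hf' using fun V : 𝒱 => exists_le_finrank_eq V.1 (hdim V.1 V.2)
  rw [← card_submodule_finrank_eq, Nat.cast_le, ← Nat.card_eq_finsetCard]
  refine Nat.card_le_card_of_injective (fun V => ⟨f V, hf' V⟩) fun U V h => ?_
  by_contra hne
  have h : f U = f V := congrArg Subtype.val h
  have h1 := hinter U.1 U.2 V.1 V.2 fun h => hne (Subtype.ext h)
  have h2 := Submodule.finrank_mono (le_inf (hf U) (h ▸ hf V))
  rw [hf'] at h2
  omega

end Subspaces

/-! ### The case `0 ∈ L` with `L` not an initial segment. -/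

section ZeroMem

variable {F W : Type*} [Field F] [Fintype F] [AddCommGroup W] [Module F W] [FiniteDimensional F W]

/-- Counting incidences with nonzero vectors: a bound on the number of members through each nonzero
vector gives a bound on the number of members. -/
theorem card_mul_pow_sub_one_le {𝒱 : Finset (Submodule F W)} {d : ℕ} {B : ℝ}
    (hd : ∀ V ∈ 𝒱, d ≤ finrank F V)
    (hB : ∀ 𝒰 ⊆ 𝒱, ∀ v : W, v ≠ 0 → (∀ V ∈ 𝒰, v ∈ V) → (𝒰.card : ℝ) ≤ B) :
    (𝒱.card : ℝ) * ((Fintype.card F : ℝ) ^ d - 1) ≤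
      ((Fintype.card F : ℝ) ^ finrank F W - 1) * B := by
  classical
  have : Finite W := Module.finite_of_finite F
  have : Fintype W := Fintype.ofFinite W
  have hq : (1 : ℝ) ≤ Fintype.card F := by exact_mod_cast Fintype.card_pos
  have hcount := Finset.sum_card_bipartiteAbove_eq_sum_card_bipartiteBelow
    (fun (V : Submodule F W) (v : W) => v ∈ V) (s := 𝒱) (t := Finset.univ.erase 0)
  have h1 : ∀ V ∈ 𝒱, (Fintype.card F : ℝ) ^ d - 1 ≤
      (((Finset.univ.erase (0 : W)).bipartiteAbove (fun V v => v ∈ V) V).card : ℝ) := by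
    intro V hV
    have h2 : (Finset.univ.erase (0 : W)).bipartiteAbove (fun V v => v ∈ V) V =
        (Finset.univ.filter (· ∈ V)).erase 0 := by
      ext v
      simp [Finset.mem_bipartiteAbove]
    rw [h2, Finset.cast_card_erase_of_mem (by simp), ← Fintype.card_subtype]
    have h3 : Fintype.card {v // v ∈ V} = Fintype.card F ^ finrank F V :=
      Module.card_eq_pow_finrank (K := F) (V := V)
    rw [h3, Nat.cast_pow]
    have := pow_le_pow_right₀ hq (hd V hV)
    linarith
  calc (𝒱.card : ℝ) * ((Fintype.card F : ℝ) ^ d - 1)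
      = ∑ V ∈ 𝒱, ((Fintype.card F : ℝ) ^ d - 1) := by rw [Finset.sum_const, nsmul_eq_mul]
    _ ≤ ∑ V ∈ 𝒱, (((Finset.univ.erase (0 : W)).bipartiteAbove (fun V v => v ∈ V) V).card : ℝ) :=
        Finset.sum_le_sum h1
    _ = ∑ v ∈ Finset.univ.erase (0 : W),
          ((𝒱.bipartiteBelow (fun V v => v ∈ V) v).card : ℝ) := by exact_mod_cast hcount
    _ ≤ ∑ v ∈ Finset.univ.erase (0 : W), B := Finset.sum_le_sum fun v hv =>
        hB _ (Finset.filter_subset _ _) v (Finset.ne_of_mem_erase hv) fun V hV =>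
          (Finset.mem_filter.1 hV).2
    _ = ((Fintype.card F : ℝ) ^ finrank F W - 1) * B := by
        rw [Finset.sum_const, nsmul_eq_mul, Finset.cast_card_erase_of_mem (Finset.mem_univ _),
          Finset.card_univ, Module.card_eq_pow_finrank (K := F), Nat.cast_pow]

theorem two_le_card : (2 : ℝ) ≤ Fintype.card F := by exact_mod_cast Fintype.one_lt_card

/-- With `s = L.card`, members of dimension at most `s` number at most a third of `[n, s]`, and the
others fewer than two thirds. -/
theorem card_lt_gaussBinom_of_zero_mem {L : Finset ℕ} {𝒱 : Finset (Submodule F W)}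
    (hinter : ∀ U ∈ 𝒱, ∀ V ∈ 𝒱, U ≠ V → finrank F (U ⊓ V : Submodule F W) ∈ L)
    (hdim : ∀ V ∈ 𝒱, finrank F V ∉ L) (h0 : 0 ∈ L) (hL : L ≠ Finset.range L.card)
    (hn : 2 * L.card + 1 ≤ finrank F W) :
    (𝒱.card : ℝ) < gaussBinom (Fintype.card F) (finrank F W) L.card := by
  classical
  obtain ⟨r, hr⟩ : ∃ r, L.card = r + 1 :=
    ⟨L.card - 1, by have := Finset.card_pos.2 ⟨0, h0⟩; omega⟩
  obtain ⟨m, hm⟩ : ∃ m, finrank F W = m + 1 := ⟨finrank F W - 1, by omega⟩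
  have hq := two_le_card (F := F)
  have hsplit := Finset.card_filter_add_card_filter_not (s := 𝒱)
    (fun V : Submodule F W => finrank F V ≤ r + 1)
  set small := 𝒱.filter fun V : Submodule F W => finrank F V ≤ r + 1
  set large := 𝒱.filter fun V : Submodule F W => ¬ finrank F V ≤ r + 1
  have hsmall : (small.card : ℝ) ≤ gaussBinomSum (Fintype.card F) (finrank F W) r := by
    refine card_le_gaussBinomSum (L := L.filter (· < r + 1)) ?_ ?_ ?_
    · intro U hU V hV h
      obtain ⟨hU, hU'⟩ := Finset.mem_filter.1 hU
      have h1 := hinter U hU V (Finset.mem_filter.1 hV).1 h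
      refine Finset.mem_filter.2 ⟨h1, lt_of_lt_of_le (lt_of_le_of_ne
        (Submodule.finrank_mono inf_le_left) fun h2 => hdim U hU (h2 ▸ h1)) hU'⟩
    · exact fun V hV h => hdim V (Finset.mem_filter.1 hV).1 (Finset.mem_filter.1 h).1
    · suffices h : L.filter (· < r + 1) ⊂ L from
        Nat.lt_succ_iff.1 ((Finset.card_lt_card h).trans_eq hr)
      refine Finset.filter_ssubset.2 ?_
      by_contra! h
      exact hL (Finset.eq_of_subset_of_card_le (fun l hl => by
        rw [Finset.mem_range, hr]; exact h l hl) (by simp))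
  -- Large members have dimension at least `s + 1 = r + 2`. This extra dimension later yields the
  -- factor 2 in `h5`.
  have hlarge := card_mul_pow_sub_one_le (𝒱 := large) (d := r + 2)
    (B := gaussBinomSum (Fintype.card F) m r)
    (fun V hV => by have := (Finset.mem_filter.1 hV).2; omega) (by
      intro 𝒰 h𝒰 v hv hmem
      have hsub : ∀ V ∈ 𝒰, V ∈ 𝒱 := fun V hV => (Finset.mem_filter.1 (h𝒰 hV)).1
      have hZ : finrank F (F ∙ v) = 1 := finrank_span_singleton hv
      have hle : ∀ V ∈ 𝒰, F ∙ v ≤ V := fun V hV =>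
        (Submodule.span_singleton_le_iff_mem _ _).2 (hmem V hV)
      have := card_le_gaussBinomSum_of_forall_le (L := L.erase 0) (r := r) hle
        (fun l hl => by have := Finset.ne_of_mem_erase hl; omega)
        (fun U hU V hV h => Finset.mem_erase.2 ⟨by
          have := Submodule.finrank_mono (le_inf (hle U hU) (hle V hV)); omega,
          hinter U (hsub U hU) V (hsub V hV) h⟩)
        (fun V hV h => hdim V (hsub V hV) (Finset.mem_of_mem_erase h))
        (by rw [Finset.card_erase_of_mem h0]; omega)
      rwa [hZ, hm, Nat.add_sub_cancel] at this)
  have h1 := three_mul_gaussBinomSum_le hq (m := finrank F W) (r := r) (by omega)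
  have h2 := gaussBinomSum_le hq (m := m) (r := r) (by omega)
  have h3 := gaussBinom_succ_succ (q := Fintype.card F) (by linarith) m r
  have hpos : 0 < gaussBinom (Fintype.card F) (m + 1) (r + 1) :=
    gaussBinom_pos (by linarith) (by omega)
  rw [hr]
  rw [hm] at hsmall hlarge h1 ⊢
  rw [← hsplit, Nat.cast_add]
  have hp : (1 : ℝ) ≤ (Fintype.card F : ℝ) ^ (r + 1) := one_le_pow₀ (by linarith)
  have hp' : (1 : ℝ) ≤ (Fintype.card F : ℝ) ^ (m + 1) := one_le_pow₀ (by linarith)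
  have h4 : 3 * (large.card : ℝ) < 2 * gaussBinom (Fintype.card F) (m + 1) (r + 1) := by
    have h5 : 2 * ((Fintype.card F : ℝ) ^ (r + 1) - 1) < (Fintype.card F : ℝ) ^ (r + 2) - 1 := by
      rw [pow_succ _ (r + 1)]
      nlinarith
    refine lt_of_mul_lt_mul_right ?_ (by linarith : 0 ≤ (Fintype.card F : ℝ) ^ (r + 2) - 1)
    have h6 := mul_lt_mul_of_pos_left h5 hpos
    have h7 := mul_le_mul_of_nonneg_left h2 (sub_nonneg.2 hp')
    linarith
  linarith

end ZeroMem

/-! ### The case of positive smallest element: sunflowers. -/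

section Sunflower

variable {F W : Type*} [Field F] [AddCommGroup W] [Module F W] [FiniteDimensional F W]

theorem finrank_inf_add_finrank_inf_le (U X V : Submodule F W) :
    finrank F (U ⊓ X : Submodule F W) + finrank F (U ⊓ V : Submodule F W) ≤
      finrank F (U ⊓ (X ⊔ V) : Submodule F W) + finrank F (U ⊓ (X ⊓ V) : Submodule F W) := by
  rw [← Submodule.finrank_sup_add_finrank_inf_eq, inf_inf_inf_comm, inf_idem]
  exact Nat.add_le_add_right (Submodule.finrank_mono
    (sup_le (inf_le_inf_left _ le_sup_left) (inf_le_inf_left _ le_sup_right))) _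

/-- The sunflower argument: `X` is the span of `m` members that form a sunflower with kernel `C`,
which is extended until every member meets `X` in dimension more than `l`. -/
theorem exists_small_or_sunflower {𝒱 : Finset (Submodule F W)} {k l : ℕ} (hk : 2 ≤ k)
    (hdim : ∀ V ∈ 𝒱, finrank F V ≤ k)
    (hinter : ∀ U ∈ 𝒱, ∀ V ∈ 𝒱, l ≤ finrank F (U ⊓ V : Submodule F W))
    (hne : 𝒱.Nonempty) {m : ℕ} (hm : 2 ≤ m) (hmk : m ≤ k + 1) :
    (∃ X : Submodule F W, finrank F X ≤ k ^ 2 ∧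
      ∀ V ∈ 𝒱, l + 1 ≤ finrank F (V ⊓ X : Submodule F W)) ∨
    ∃ X C : Submodule F W, finrank F C = l ∧ finrank F X ≤ m * k ∧
      (∀ V ∈ 𝒱, finrank F (V ⊓ X : Submodule F W) ≤ l → V ⊓ X = C) ∧
      ∀ V ∈ 𝒱, C ≤ V ∨ l + m ≤ finrank F (V ⊓ X : Submodule F W) + 1 := by
  induction m, hm using Nat.le_induction with
  | base =>
    obtain ⟨U, hU⟩ := hne
    by_cases h : ∀ V ∈ 𝒱, l + 1 ≤ finrank F (V ⊓ U : Submodule F W)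
    · exact Or.inl ⟨U, (hdim U hU).trans (by nlinarith), h⟩
    push Not at h
    obtain ⟨U', hU', h⟩ := h
    have hC : finrank F (U ⊓ U' : Submodule F W) = l := by
      have := hinter U hU U' hU'
      rw [inf_comm] at h
      omega
    refine Or.inr ⟨U ⊔ U', U ⊓ U', hC, ?_, ?_, ?_⟩
    · have h1 := Submodule.finrank_add_le_finrank_add_finrank U U'
      have h2 := hdim U hU
      have h3 := hdim U' hU'
      omega
    · intro V hV hVl
      have h1 : V ⊓ U = V ⊓ (U ⊔ U') := Submodule.eq_of_le_of_finrank_le (inf_le_inf_left _ le_sup_left)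
        (hVl.trans (hinter V hV U hU))
      have h2 : V ⊓ U' = V ⊓ (U ⊔ U') := Submodule.eq_of_le_of_finrank_le (inf_le_inf_left _ le_sup_right)
        (hVl.trans (hinter V hV U' hU'))
      refine Submodule.eq_of_le_of_finrank_le (le_inf (h1 ▸ inf_le_right) (h2 ▸ inf_le_right)) ?_
      rw [hC, ← h1]
      exact hinter V hV U hU
    · intro V hV
      refine or_iff_not_imp_left.2 fun hCV => ?_
      have h1 := finrank_inf_add_finrank_inf_le V U U'
      have h2 := Submodule.finrank_lt_finrank_of_lt
        (lt_of_le_of_ne (inf_le_right : V ⊓ (U ⊓ U') ≤ _) fun h => hCV (inf_eq_right.1 h))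
      have h3 := hinter V hV U hU
      have h4 := hinter V hV U' hU'
      omega
  | succ m hm ih =>
    refine (ih (by omega)).elim Or.inl ?_
    rintro ⟨X, C, hC, hX, hXC, hV⟩
    by_cases h : ∀ V ∈ 𝒱, l + 1 ≤ finrank F (V ⊓ X : Submodule F W)
    · exact Or.inl ⟨X, hX.trans (by nlinarith), h⟩
    push Not at h
    obtain ⟨U', hU', h⟩ := h
    have hU'X := hXC U' hU' (by omega)
    have hCX : C ≤ X := hU'X ▸ inf_le_right
    refine Or.inr ⟨X ⊔ U', C, hC, ?_, ?_, ?_⟩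
    · have h1 := Submodule.finrank_add_le_finrank_add_finrank X U'
      have h2 := hdim U' hU'
      rw [add_mul]
      omega
    · intro V hVV hVl
      have hle : V ⊓ X ≤ V ⊓ (X ⊔ U') := inf_le_inf_left _ le_sup_left
      have h1 := hXC V hVV ((Submodule.finrank_mono hle).trans hVl)
      rw [h1] at hle
      exact (Submodule.eq_of_le_of_finrank_le hle (by omega)).symm
    -- If `V` misses part of `C = U' ⊓ X`, modularity gives `dim (V ⊓ (X ⊔ U')) ≥ (l + m - 1) + l -
    -- (l - 1) = l + m`: each new petal adds at least one dimension.
    · intro V hVV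
      refine or_iff_not_imp_left.2 fun hCV => ?_
      have h1 := finrank_inf_add_finrank_inf_le V X U'
      rw [inf_comm X U', hU'X] at h1
      have h2 := Submodule.finrank_lt_finrank_of_lt
        (lt_of_le_of_ne (inf_le_right : V ⊓ C ≤ C) fun h => hCV (inf_eq_right.1 h))
      have h3 := (hV V hVV).resolve_left hCV
      have h4 := hinter V hVV U' hU'
      omega

/-- Either all members share an `l`-dimensional subspace, or they all meet a fixed subspace of
dimension at most `k ^ 2` in dimension more than `l`. -/
theorem exists_small_or_common {𝒱 : Finset (Submodule F W)} {k l : ℕ} (hk : 2 ≤ k) (hl : 1 ≤ l)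
    (hdim : ∀ V ∈ 𝒱, finrank F V ≤ k)
    (hinter : ∀ U ∈ 𝒱, ∀ V ∈ 𝒱, l ≤ finrank F (U ⊓ V : Submodule F W)) (hne : 𝒱.Nonempty) :
    (∃ X : Submodule F W, finrank F X ≤ k ^ 2 ∧
      ∀ V ∈ 𝒱, l + 1 ≤ finrank F (V ⊓ X : Submodule F W)) ∨
    ∃ C : Submodule F W, finrank F C = l ∧ ∀ V ∈ 𝒱, C ≤ V := by
  refine (exists_small_or_sunflower hk hdim hinter hne (m := k + 1) (by omega) le_rfl).imp_right ?_
  rintro ⟨X, C, hC, -, -, h⟩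
  -- With `k + 1` petals, a member not containing `C` would have dimension at least `l + k > k`.
  refine ⟨C, hC, fun V hV => (h V hV).resolve_right fun h1 => ?_⟩
  have h2 : finrank F (V ⊓ X : Submodule F W) ≤ finrank F V := Submodule.finrank_mono inf_le_left
  have h3 := hdim V hV
  omega

/-- Every member contains some `d`-subspace of `X`, so a union bound over these applies. -/
theorem card_le_mul_of_le_finrank_inf [Fintype F] {𝒱 : Finset (Submodule F W)}
    {X : Submodule F W} {d : ℕ} {B : ℝ}
    (hX : ∀ V ∈ 𝒱, d ≤ finrank F (V ⊓ X : Submodule F W))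
    (hB : ∀ 𝒰 ⊆ 𝒱, ∀ Z : Submodule F W, finrank F Z = d → (∀ V ∈ 𝒰, Z ≤ V) → (𝒰.card : ℝ) ≤ B) :
    (𝒱.card : ℝ) ≤ gaussBinom (Fintype.card F) (finrank F X) d * B := by
  classical
  have : Finite W := Module.finite_of_finite F
  have : Fintype {Z : Submodule F X // finrank F Z = d} := Fintype.ofFinite _
  have hsub : 𝒱 ⊆ (Finset.univ : Finset {Z : Submodule F X // finrank F Z = d}).biUnion
      fun Z => 𝒱.filter (Z.1.map X.subtype ≤ ·) := by
    intro V hV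
    obtain ⟨Z, hZ, hZd⟩ := exists_le_finrank_eq _ (hX V hV)
    have hmap : (Z.comap X.subtype).map X.subtype = Z :=
      Submodule.map_comap_eq_of_le (by rw [Submodule.range_subtype]; exact hZ.trans inf_le_right)
    refine Finset.mem_biUnion.2 ⟨⟨Z.comap X.subtype, ?_⟩, Finset.mem_univ _,
      Finset.mem_filter.2 ⟨hV, ?_⟩⟩
    · rw [← Submodule.finrank_map_subtype_eq, hmap, hZd]
    · simp only [hmap]
      exact hZ.trans inf_le_left
  calc (𝒱.card : ℝ) ≤ ((∑ Z : {Z : Submodule F X // finrank F Z = d},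
        (𝒱.filter (Z.1.map X.subtype ≤ ·)).card : ℕ) : ℝ) := by
        exact_mod_cast (Finset.card_le_card hsub).trans Finset.card_biUnion_le
    _ = ∑ Z : {Z : Submodule F X // finrank F Z = d},
        ((𝒱.filter (Z.1.map X.subtype ≤ ·)).card : ℝ) := Nat.cast_sum _ _
    _ ≤ ∑ Z : {Z : Submodule F X // finrank F Z = d}, B := Finset.sum_le_sum fun Z _ =>
        hB _ (Finset.filter_subset _ _) _ (by rw [Submodule.finrank_map_subtype_eq, Z.2])
          fun V hV => (Finset.mem_filter.1 hV).2
    _ = gaussBinom (Fintype.card F) (finrank F X) d * B := by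
        rw [Finset.sum_const, nsmul_eq_mul, Finset.card_univ, ← card_submodule_finrank_eq,
          Nat.card_eq_fintype_card]

theorem card_lt_gaussBinom_of_pos [Fintype F] {L : Finset ℕ} {𝒱 : Finset (Submodule F W)} {k l : ℕ}
    (hinter : ∀ U ∈ 𝒱, ∀ V ∈ 𝒱, U ≠ V → finrank F (U ⊓ V : Submodule F W) ∈ L)
    (hdim : ∀ V ∈ 𝒱, finrank F V ∉ L) (hk : ∀ V ∈ 𝒱, finrank F V ≤ k)
    (hl : 1 ≤ l) (hlL : l ∈ L) (hL : ∀ i ∈ L, l ≤ i) (hn : 2 * L.card + 1 ≤ finrank F W)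
    (hnk : ((Fintype.card F : ℝ) ^ L.card - 1) * gaussBinom (Fintype.card F) (k ^ 2) (l + 1) + 1 ≤
      (Fintype.card F : ℝ) ^ (finrank F W - l)) :
    (𝒱.card : ℝ) < gaussBinom (Fintype.card F) (finrank F W) L.card := by
  classical
  obtain ⟨r, hr⟩ : ∃ r, L.card = r + 1 :=
    ⟨L.card - 1, by have := Finset.card_pos.2 ⟨l, hlL⟩; omega⟩
  obtain ⟨m, hm⟩ : ∃ m, finrank F W = m + 1 := ⟨finrank F W - 1, by omega⟩
  have hq := two_le_card (F := F)
  have hq1 : (1 : ℝ) < Fintype.card F := by linarith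
  have hlt := gaussBinomSum_lt hq (m := m) (r := r) (by omega)
  rw [hr] at hn hnk ⊢
  rw [hm] at hn hnk ⊢
  -- A lone member may have dimension below `l`; with two members, each has an intersection of
  -- dimension at least `l` inside it.
  rcases le_or_gt 𝒱.card 1 with h1 | h1
  · refine lt_of_le_of_lt ?_ hlt
    exact (by exact_mod_cast h1 : (𝒱.card : ℝ) ≤ 1).trans (one_le_gaussBinomSum hq1.le _ _)
  obtain ⟨U₀, hU₀, V₀, hV₀, hUV⟩ := Finset.one_lt_card.1 h1
  have hlt_dim : ∀ V ∈ 𝒱, l + 1 ≤ finrank F V := by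
    intro V hV
    obtain ⟨U, hU, hne⟩ : ∃ U ∈ 𝒱, V ≠ U := by
      by_cases h : V = U₀
      · exact ⟨V₀, hV₀, h ▸ hUV⟩
      · exact ⟨U₀, hU₀, h⟩
    have h2 := hinter V hV U hU hne
    have h3 : finrank F (V ⊓ U : Submodule F W) ≤ finrank F V := Submodule.finrank_mono inf_le_left
    have h4 := hL _ h2
    have h5 : finrank F V ≠ l := fun h => hdim V hV (h ▸ hlL)
    omega
  have hl_inter : ∀ U ∈ 𝒱, ∀ V ∈ 𝒱, l ≤ finrank F (U ⊓ V : Submodule F W) := by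
    intro U hU V hV
    by_cases h : U = V
    · subst h
      rw [inf_idem]
      exact (Nat.le_succ l).trans (hlt_dim U hU)
    · exact hL _ (hinter U hU V hV h)
  have hk2 : l + 1 ≤ k := (hlt_dim U₀ hU₀).trans (hk U₀ hU₀)
  rcases exists_small_or_common (by omega) hl hk hl_inter ⟨U₀, hU₀⟩ with ⟨X, hX, hXV⟩ | ⟨C, hC, hCV⟩
  -- Members through a fixed `(l + 1)`-subspace never meet in dimension `l`, so only `r`
  -- intersection dimensions remain.
  · have h2 := card_le_mul_of_le_finrank_inf (B := gaussBinomSum (Fintype.card F) m r) hXV (by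
      intro 𝒰 h𝒰 Z hZ hZV
      refine (card_le_gaussBinomSum_of_forall_le (L := L.erase l) (r := r) hZV ?_ ?_ ?_ ?_).trans
        (gaussBinomSum_mono hq1.le (by omega) le_rfl)
      · intro i hi
        have h3 := Finset.ne_of_mem_erase hi
        have h4 := hL i (Finset.mem_of_mem_erase hi)
        omega
      · intro U hU V hV h
        have h3 := Submodule.finrank_mono (le_inf (hZV U hU) (hZV V hV))
        exact Finset.mem_erase.2 ⟨by omega, hinter U (h𝒰 hU) V (h𝒰 hV) h⟩
      · exact fun V hV h => hdim V (h𝒰 hV) (Finset.mem_of_mem_erase h)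
      · rw [Finset.card_erase_of_mem hlL]
        omega)
    have h3 := gaussBinomSum_le hq (m := m) (r := r) (by omega)
    have h4 := gaussBinom_succ_succ hq1 m r
    have h5 : 0 < gaussBinom (Fintype.card F) m r := gaussBinom_pos hq1 (by omega)
    have h6 := gaussBinom_mono_left hq1.le hX (l + 1)
    have h7 := one_le_gaussBinomSum hq1.le m r
    have hp : 0 < (Fintype.card F : ℝ) ^ (r + 1) - 1 :=
      sub_pos.2 (one_lt_pow₀ hq1 (Nat.succ_ne_zero r))
    refine lt_of_mul_lt_mul_right ?_ hp.le
    rw [h4]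
    have h8 : (Fintype.card F : ℝ) ^ (m + 1 - l) ≤ (Fintype.card F : ℝ) ^ m :=
      pow_le_pow_right₀ hq1.le (by omega)
    have h9 : 2 * (Fintype.card F : ℝ) ^ m ≤ (Fintype.card F : ℝ) ^ (m + 1) := by
      rw [pow_succ']
      gcongr
    have h10 : (1 : ℝ) ≤ (Fintype.card F : ℝ) ^ m := one_le_pow₀ hq1.le
    calc (𝒱.card : ℝ) * ((Fintype.card F : ℝ) ^ (r + 1) - 1)
        ≤ gaussBinom (Fintype.card F) (k ^ 2) (l + 1) * gaussBinomSum (Fintype.card F) m r *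
          ((Fintype.card F : ℝ) ^ (r + 1) - 1) := by gcongr; exact h2.trans (by gcongr)
      _ = ((Fintype.card F : ℝ) ^ (r + 1) - 1) * gaussBinom (Fintype.card F) (k ^ 2) (l + 1) *
          gaussBinomSum (Fintype.card F) m r := by ring
      _ ≤ ((Fintype.card F : ℝ) ^ m - 1) * gaussBinomSum (Fintype.card F) m r := by
          gcongr
          linarith
      _ < gaussBinom (Fintype.card F) m r * ((Fintype.card F : ℝ) ^ (m + 1) - 1) := by
          have h11 := mul_le_mul_of_nonneg_left h3 (sub_nonneg.2 h10)
          have h12 := mul_le_mul_of_nonneg_left h9 h5.le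
          have h13 := mul_le_mul_of_nonneg_left h10 h5.le
          linarith
  · refine lt_of_le_of_lt ?_ hlt
    refine (card_le_gaussBinomSum_of_forall_le hCV (fun i hi => hC ▸ hL i hi) hinter hdim
      hr.le).trans (gaussBinomSum_mono hq1.le (by omega) le_rfl)

end Sunflower

/-! ### The Sperner property and the assembly of the cases. -/

theorem isAntichain_of_finrank_inf_mem {F W : Type*} [Field F] [AddCommGroup W] [Module F W]
    {L : Finset ℕ} {𝒱 : Finset (Submodule F W)}
    (hinter : ∀ U ∈ 𝒱, ∀ V ∈ 𝒱, U ≠ V → finrank F (U ⊓ V : Submodule F W) ∈ L)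
    (hdim : ∀ V ∈ 𝒱, finrank F V ∉ L) : IsAntichain (· ≤ ·) (𝒱 : Set (Submodule F W)) := by
  intro U hU V hV hne hle
  have h := hinter U hU V hV hne
  rw [inf_eq_left.2 hle] at h
  exact hdim U hU h

end SubspaceFamilies

theorem corollary1p17 {F W : Type*} [Field F] [Fintype F] [AddCommGroup W] [Module F W]
    [FiniteDimensional F W] (q n s : ℕ) (hq : Fintype.card F = q) (hn : Module.finrank F W = n)
    (L : Finset ℕ) (hL : L.Nonempty) (hs : L.card = s)
    (𝒱 : Finset (Submodule F W))
    (hinter : ∀ U ∈ 𝒱, ∀ V ∈ 𝒱, U ≠ V → Module.finrank F (U ⊓ V : Submodule F W) ∈ L)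
    (hdim : ∀ V ∈ 𝒱, Module.finrank F V ∉ L) :
    IsAntichain (· ≤ ·) (𝒱 : Set (Submodule F W)) ∧
    (max (Real.logb q (((q : ℝ) ^ s - 1) * gaussBinom q (maxDim 𝒱 ^ 2) (L.min' hL + 1) + 1)
          + (L.min' hL : ℝ)) (2 * (s : ℝ) + 1) ≤ (n : ℝ) →
      (𝒱.card : ℝ) ≤ gaussBinom q n s ∧
      ((𝒱.card : ℝ) = gaussBinom q n s → L = Finset.range s)) := by
  refine ⟨isAntichain_of_finrank_inf_mem hinter hdim, fun h => ?_⟩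
  subst hq hn hs
  obtain ⟨hlog, hn⟩ := max_le_iff.1 h
  replace hn : 2 * L.card + 1 ≤ Module.finrank F W := by exact_mod_cast hn
  by_cases hrange : L = Finset.range L.card
  · refine ⟨card_le_gaussBinom_of_finrank_inf_lt (fun U hU V hV hne => ?_) (fun V hV => ?_),
      fun _ => hrange⟩
    · exact Finset.mem_range.1 (hrange ▸ hinter U hU V hV hne)
    · exact not_lt.1 fun hlt => hdim V hV (hrange ▸ Finset.mem_range.2 hlt)
  suffices hlt : (𝒱.card : ℝ) < gaussBinom (Fintype.card F) (Module.finrank F W) L.card from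
    ⟨hlt.le, fun heq => absurd heq hlt.ne⟩
  rcases Nat.eq_zero_or_pos (L.min' hL) with h0 | hpos
  · exact card_lt_gaussBinom_of_zero_mem hinter hdim (h0 ▸ L.min'_mem hL) hrange hn
  · have hq1 : (1 : ℝ) < Fintype.card F := by exact_mod_cast Fintype.one_lt_card
    refine card_lt_gaussBinom_of_pos (k := maxDim 𝒱) hinter hdim
      (fun V hV => Finset.le_sup (f := fun V : Submodule F W => Module.finrank F V) hV) hpos (L.min'_mem hL)
      (fun i hi => L.min'_le i hi) hn ?_
    set A := ((Fintype.card F : ℝ) ^ L.card - 1) *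
      gaussBinom (Fintype.card F) (maxDim 𝒱 ^ 2) (L.min' hL + 1)
    have hA : 0 ≤ A := mul_nonneg (sub_nonneg.2 (one_le_pow₀ hq1.le)) (gaussBinom_nonneg hq1.le _ _)
    have hlog0 : 0 ≤ Real.logb (Fintype.card F) (A + 1) := Real.logb_nonneg hq1 (by linarith)
    -- Nonnegativity of the logarithm gives `l₁ ≤ n`, so the natural subtraction `n - l₁` agrees
    -- with the real one.
    have hle : L.min' hL ≤ Module.finrank F W := by
      exact_mod_cast (by linarith : (L.min' hL : ℝ) ≤ Module.finrank F W)
    rw [← Real.rpow_natCast, Nat.cast_sub hle, ← Real.logb_le_iff_le_rpow hq1 (by linarith)]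
    linarith
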